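/- Let $0<\lambda<\lambda_0:=\frac{\sqrt6-1}{5}$ and let $(p_n)_{n\ge 0}$ be a sequence of positive numbers with $p_{n+1}\le\lambda p_n$ for all $n$. Consider the infinite step billiard with table $\mathcal P=\bigcup_{n\ge 0}[n,n+1]\times[0,p_n]$: a point particle moves at unit speed in $\mathcal P$ with elastic reflections at the sides. For $\vartheta\in\,]0,\pi/2[$ consider the trajectories whose velocity takes the four values $(\pm\cos\vartheta,\pm\sin\vartheta)$, described as the flow in the constant direction $(\cos\vartheta,\sin\vartheta)$ on the invariant surface obtained by unfolding four copies of $\mathcal P$ in the plane, with coordinates $(X,Y)$, $|X|=x$, $|Y|=y$, and identifying the corresponding sides; a trajectory which reaches a reentrant corner $(k,p_k)$, $k\ge1$, is continued by continuity from above in $Y$, so that every orbit is defined for all times $t\in\mathbb R$. An orbit is called an escape orbit if its $x$-coordinate tends to $+\infty$ as $t\to+\infty$. Then for Lebesgue-almost every direction $\vartheta\in\,]0,\pi/2[$ there is exactly one escape orbit $\eta_\vartheta$ of direction $\vartheta$, and $\eta_\vartheta$ (its whole past and future) does not pass through any vertex of the table, that is, through any of the points $(0,0)$, $(0,p_0)$,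 $(n,p_n)$ and $(n,p_{n-1})$ with $n\ge 1$. -/

import Mathlib

namespace StepBilliard

/-- The infinite step table: the union over `n` of the rectangles `[n, n+1] × [0, p n]`. -/
def table (p : ℕ → ℝ) : Set (ℝ × ℝ) :=
  ⋃ n : ℕ, Set.Icc (n : ℝ) (n + 1) ×ˢ Set.Icc (0 : ℝ) (p n)

/-- All corners of the table: the two on the left wall, the reentrant (`3π/2`) corners
`(k, p k)` and the convex (`π/2`) corners `(k, p (k - 1))`, where `k = n + 1 ≥ 1`. -/
def vertices (p : ℕ → ℝ) : Set (ℝ × ℝ) :=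
  {(0, 0), (0, p 0)} ∪
    {v | ∃ n : ℕ, v = ((n : ℝ) + 1, p (n + 1)) ∨ v = ((n : ℝ) + 1, p n)}

/-- Half the height of the unfolded table over the strip `j ≤ X ≤ j + 1`: this is `p n` over
`[n, n+1]` and over its mirror image `[-(n+1), -n]`. -/
def halfHeight (p : ℕ → ℝ) : ℤ → ℝ
  | Int.ofNat n => p n
  | Int.negSucc n => p n

/-- The invariant surface, obtained by unfolding four copies of the table, in the planar
coordinates `(X, Y)`. A billiard particle at `(x, y)` moving in the direction
`(σ cos θ, τ sin θ)`, with `σ, τ = ±1`, is the point `(X, Y) = (σ x, τ y)`, so that on the surface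
it moves in the constant direction `(cos θ, sin θ)`. Horizontal sides `Y = ± p n` over the same
strip are identified with each other, and so are the walls at `X = n` and `X = - n`
(where `p n ≤ |Y| ≤ p (n-1)`). The set below keeps one representative of each regular point:
the bottom one of `Y = ± p n`, and the left one (`X = - n`) for the walls. -/
def surface (p : ℕ → ℝ) : Set (ℝ × ℝ) :=
  {z | -halfHeight p ⌊z.1⌋ ≤ z.2 ∧ z.2 < halfHeight p ⌊z.1⌋}

/-- The folding map, from the surface to the table. -/
def fold (z : ℝ × ℝ) : ℝ × ℝ := (|z.1|, |z.2|)

/-- The folding map takes the surface into the table. -/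
theorem fold_mem {p : ℕ → ℝ} {z : ℝ × ℝ} (hz : z ∈ surface p) : fold z ∈ table p := by
  obtain ⟨h1, h2⟩ := hz
  have ha := Int.floor_le z.1
  have hb := Int.lt_floor_add_one z.1
  simp only [table, Set.mem_iUnion, Set.mem_prod, Set.mem_Icc, fold]
  cases hj : ⌊z.1⌋ with
  | ofNat n =>
    rw [hj] at h1 h2 ha hb
    simp [halfHeight] at h1 h2 ha hb
    have : (0:ℝ) ≤ n := by positivity
    refine ⟨n, ⟨?_, ?_⟩, abs_nonneg _, abs_le.2 ⟨by linarith, by linarith⟩⟩ <;>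
      rw [abs_of_nonneg (by linarith)] <;> linarith
  | negSucc n =>
    rw [hj] at h1 h2 ha hb
    simp [halfHeight, Int.cast_negSucc] at h1 h2 ha hb
    have : (0:ℝ) ≤ n := by positivity
    refine ⟨n, ⟨?_, ?_⟩, abs_nonneg _, abs_le.2 ⟨by linarith, by linarith⟩⟩ <;>
      rw [abs_of_neg (by linarith)] <;> linarith

/-- Side identification for a point `z` which is the end point of a segment that travels up and to
the right inside the strip `⌈X⌉ - 1 < X < ⌈X⌉`. If it has arrived at the top side it is moved to
the bottom side; if it has arrived at a wall `X = n ≥ 1`, that is, at a point that is not in the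
aperture `{n} × [-p n, p n)`, it is moved to the mirror wall `X = - n`. At the reentrant corners
the half-open intervals implement the convention that the motion is continuous from above. -/
noncomputable def glue (p : ℕ → ℝ) (z : ℝ × ℝ) : ℝ × ℝ :=
  let y : ℝ := if z.2 = halfHeight p (⌈z.1⌉ - 1) then -z.2 else z.2
  if -halfHeight p ⌊z.1⌋ ≤ y ∧ y < halfHeight p ⌊z.1⌋ then (z.1, y) else (-z.1, y)

/-- The unit vector of direction `θ`. -/
noncomputable def direction (θ : ℝ) : ℝ × ℝ := (Real.cos θ, Real.sin θ)

/-- `γ` is a complete (two-sided) trajectory of the billiard flow of direction `θ` on the surface,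
parametrised by time: it stays on the surface; after every instant it travels for a while in a
straight line in direction `θ` at unit speed; and before every instant `t` it travelled for a while
in such a straight line, towards a point `e` that the side identifications send to `γ t`. -/
def IsTrajectory (p : ℕ → ℝ) (θ : ℝ) (γ : ℝ → ℝ × ℝ) : Prop :=
  ∀ t : ℝ, γ t ∈ surface p ∧
    (∃ ε > 0, ∀ s : ℝ, 0 ≤ s → s < ε → γ (t + s) = γ t + s • direction θ) ∧
    (∃ ε > 0, ∃ e : ℝ × ℝ,
      (∀ s : ℝ, 0 < s → s < ε → γ (t - s) = e - s • direction θ) ∧ γ t = glue p e)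

/-- `η` is an escape orbit of direction `θ`: the orbit (the set of all points, past and future) of
a trajectory whose position in the table goes to infinity along the cusp as `t → +∞`. -/
def IsEscapeOrbit (p : ℕ → ℝ) (θ : ℝ) (η : Set (ℝ × ℝ)) : Prop :=
  ∃ γ : ℝ → ℝ × ℝ, IsTrajectory p θ γ ∧ η = Set.range γ ∧
    Filter.Tendsto (fun t => (fold (γ t)).1) Filter.atTop Filter.atTop

end StepBilliard

/-!
A particle crosses every strip `k ≤ X < k + 1` of the unfolded table along a line of slope
`α = tan θ`, wrapping around vertically, and then either passes the aperture at `X = k + 1` or is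
moved to the mirror wall at `X = -(k + 1)`. Following the strips it visits, one sees that an escape
orbit eventually passes all apertures one after the other, that is, it escapes directly.

For a fixed vertex, the slopes for which the line through it passes the next `j` apertures form a
set of measure `O(2 ^ j * p (n + j))`, which tends to `0`. There are countably many vertices and
ways to reach them, so for almost every slope no orbit through a vertex escapes directly.

The backward beam of the aperture `m` reaches the left wall as a single interval of height
`2 * p m`, unless the ray from some corner `(k, p k)` with `k < m` passes all apertures up to `m`.
As `m → ∞` the slopes with such a corner ray have asymptotic density at most `r / (1 - 2 * r)` in
every interval, and this is less than `1` when `r < 1 / 3`. By Lebesgue's density theorem almost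
every slope admits infinitely many unsplit beams, and these nested beams shrink to exactly one
direct line.
-/

open MeasureTheory Filter Topology Set

namespace StepBilliard

section Measure

theorem measure_inter_iUnion_int_le {X : Type*} [MeasurableSpace X] (μ : Measure X)
    {A : ℤ → Set X} {D : Set X} {c : ENNReal} (M : ℕ) (hA : ∀ z, μ (A z) ≤ c)
    (hM : ∀ z w, (D ∩ A z).Nonempty → (D ∩ A w).Nonempty → z - w ≤ M) :
    μ (D ∩ ⋃ z, A z) ≤ (M + 1 : ℕ) * c := by
  by_cases hne : ∃ z, (D ∩ A z).Nonempty
  · obtain ⟨z₁, hz₁⟩ := hne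
    obtain ⟨z₀, hz₀, hmin⟩ := Int.exists_least_of_bdd (P := fun z => (D ∩ A z).Nonempty)
      ⟨z₁ - M, fun z hz => by linarith [hM z₁ z hz₁ hz]⟩ ⟨z₁, hz₁⟩
    have hsub : D ∩ ⋃ z, A z ⊆ ⋃ z ∈ Finset.Icc z₀ (z₀ + M), A z := by
      rintro x ⟨hxD, hx⟩
      obtain ⟨z, hz⟩ := mem_iUnion.1 hx
      exact mem_biUnion (Finset.mem_coe.2 (Finset.mem_Icc.2
        ⟨hmin z ⟨x, hxD, hz⟩, by linarith [hM z z₀ ⟨x, hxD, hz⟩ hz₀]⟩)) hz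
    calc μ (D ∩ ⋃ z, A z) ≤ ∑ z ∈ Finset.Icc z₀ (z₀ + M), μ (A z) :=
          (measure_mono hsub).trans (measure_biUnion_finset_le _ _)
      _ ≤ (Finset.Icc z₀ (z₀ + M)).card • c := Finset.sum_le_card_nsmul _ _ _ fun z _ => hA z
      _ = (M + 1 : ℕ) * c := by
          rw [nsmul_eq_mul, Int.card_Icc, show (z₀ + M + 1 - z₀).toNat = M + 1 by omega]
  · have hempty : D ∩ ⋃ z, A z = ∅ := by
      rw [inter_iUnion]
      exact iUnion_eq_empty.2 fun z => not_nonempty_iff_eq_empty.1 fun h => hne ⟨z, h⟩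
    simp [hempty]

theorem measure_eq_zero_of_forall_closedBall_le {X : Type*} [MetricSpace X]
    [SecondCountableTopology X] [HasBesicovitchCovering X] [MeasurableSpace X] [BorelSpace X]
    (μ : Measure X) [IsLocallyFiniteMeasure μ] {s : Set X} {c : ENNReal} (hc : c < 1)
    (h : ∀ x, ∀ r > 0, μ (s ∩ Metric.closedBall x r) ≤ c * μ (Metric.closedBall x r)) :
    μ s = 0 := by
  have hempty : ∀ᵐ _ ∂μ.restrict s, False := by
    filter_upwards [Besicovitch.ae_tendsto_measure_inter_div μ s] with x hx
    refine absurd (le_of_tendsto hx ?_) hc.not_ge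
    filter_upwards [self_mem_nhdsWithin] with r hr
    exact ENNReal.div_le_of_le_mul (h x r hr)
  simpa [ae_iff] using hempty

theorem volume_abs_mul_add_le {a : ℝ} (ha : 0 < a) (t r : ℝ) :
    volume {x : ℝ | |a * x + t| ≤ r} ≤ ENNReal.ofReal (2 * r / a) := by
  have hsub : {x : ℝ | |a * x + t| ≤ r} ⊆ Icc ((-t - r) / a) ((-t + r) / a) := by
    intro x hx
    obtain ⟨hl, hr⟩ := abs_le.1 (mem_ofPred.1 hx)
    rw [mem_Icc, div_le_iff₀ ha, le_div_iff₀ ha]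
    constructor <;> linarith
  calc volume {x : ℝ | |a * x + t| ≤ r} ≤ volume (Icc ((-t - r) / a) ((-t + r) / a)) :=
        measure_mono hsub
    _ = ENNReal.ofReal (2 * r / a) := by rw [Real.volume_Icc]; congr 1; ring

theorem ae_restrict_Ioo_tan {P : ℝ → Prop} (h : ∀ᵐ α : ℝ, P α) :
    ∀ᵐ θ ∂(volume.restrict (Ioo (0 : ℝ) (Real.pi / 2))), P (Real.tan θ) := by
  rw [ae_restrict_iff' measurableSet_Ioo, ae_iff]
  refine measure_mono_null (t := Real.arctan '' {α | ¬ P α}) ?_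
    (addHaar_image_eq_zero_of_differentiableOn_of_addHaar_eq_zero volume
      Real.differentiable_arctan.differentiableOn (ae_iff.1 h))
  intro θ hθ
  obtain ⟨⟨hθ0, hθπ⟩, hP⟩ := Classical.not_imp.1 (mem_ofPred.1 hθ)
  exact ⟨Real.tan θ, hP, Real.arctan_tan (by linarith [Real.pi_pos]) hθπ⟩

end Measure

section Corridor

variable {p : ℕ → ℝ} {r : ℝ}

theorem ratio_pos (hpos : ∀ n, 0 < p n) (hp : ∀ n, p (n + 1) ≤ r * p n) : 0 < r :=
  pos_of_mul_pos_left ((hpos 1).trans_le (hp 0)) (hpos 0).le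

theorem two_mul_lt_of_ratio (hpos : ∀ n, 0 < p n) (hr : r < 1 / 2) (hp : ∀ n, p (n + 1) ≤ r * p n)
    (n : ℕ) : 2 * p (n + 1) < p n := by
  linarith [hp n, mul_lt_mul_of_pos_right hr (hpos n)]

theorem le_ratio_pow_mul (hr : 0 ≤ r) (hp : ∀ n, p (n + 1) ≤ r * p n) (n j : ℕ) :
    p (n + j) ≤ r ^ j * p n :=
  le_geom (u := fun i => p (n + i)) hr j fun i _ => hp (n + i)

theorem tendsto_two_pow_mul (hpos : ∀ n, 0 < p n) (hr : r < 1 / 2)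
    (hp : ∀ n, p (n + 1) ≤ r * p n) (n : ℕ) :
    Tendsto (fun j => 2 ^ j * p (n + j)) atTop (𝓝 0) := by
  have hr0 := ratio_pos hpos hp
  have hgeom : Tendsto (fun j => (2 * r) ^ j * p n) atTop (𝓝 0) := by
    simpa using (tendsto_pow_atTop_nhds_zero_of_lt_one (r := 2 * r) (by linarith)
      (by linarith)).mul_const (p n)
  refine squeeze_zero (fun j => mul_nonneg (by positivity) (hpos _).le) (fun j => ?_) hgeom
  calc 2 ^ j * p (n + j) ≤ 2 ^ j * (r ^ j * p n) := by gcongr; exact le_ratio_pow_mul hr0.le hp n j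
    _ = (2 * r) ^ j * p n := by rw [mul_pow, mul_assoc]

theorem tendsto_zero_of_tendsto_two_pow_mul (hpos : ∀ n, 0 < p n)
    (h : Tendsto (fun j => 2 ^ j * p j) atTop (𝓝 0)) : Tendsto p atTop (𝓝 0) :=
  squeeze_zero (fun j => (hpos j).le)
    (fun j => le_mul_of_one_le_left (hpos j).le (one_le_pow₀ one_le_two)) h

/-- `y k`, for `k ∈ S`, are the heights at which a line of slope `α` crosses the closed apertures
`{k} × [-p k, p k]` of the unfolded table without being reflected by a vertical wall in between:
over `[k, k + 1]` the height grows by `α`, up to the identification of `p k` with `-p k`. -/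
structure IsDirectOn (p : ℕ → ℝ) (α : ℝ) (S : Set ℕ) (y : ℕ → ℝ) : Prop where
  abs_le : ∀ k ∈ S, |y k| ≤ p k
  modEq : ∀ k ∈ S, k + 1 ∈ S → y (k + 1) ≡ y k + α [PMOD 2 * p k]

theorem IsDirectOn.mono {α : ℝ} {S S' : Set ℕ} {y : ℕ → ℝ} (h : IsDirectOn p α S y)
    (hS : S' ⊆ S) : IsDirectOn p α S' y :=
  ⟨fun k hk => h.abs_le k (hS hk), fun k hk hk' => h.modEq k (hS hk) (hS hk')⟩

/-- The slopes `α` of the lines which have height `a * α + t` in the aperture of level `n` and pass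
directly through the apertures of the levels `n, …, m`. -/
def corridor (p : ℕ → ℝ) (n m : ℕ) (a t : ℝ) : Set ℝ :=
  {α | ∃ y : ℕ → ℝ, y n = a * α + t ∧ IsDirectOn p α (Icc n m) y}

theorem abs_le_of_mem_corridor {n m : ℕ} (hnm : n ≤ m) {a t α : ℝ} (h : α ∈ corridor p n m a t) :
    |a * α + t| ≤ p n := by
  obtain ⟨y, hy, hdir⟩ := h
  rw [← hy]
  exact hdir.abs_le n ⟨le_rfl, hnm⟩

theorem corridor_subset_iUnion {n m : ℕ} (hnm : n < m) (a t : ℝ) :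
    corridor p n m a t ⊆ ⋃ z : ℤ, corridor p (n + 1) m (a + 1) (t + 2 * p n * z) := by
  rintro α ⟨y, hy, hdir⟩
  obtain ⟨z, hz⟩ := AddCommGroup.modEq_iff_eq_add_zsmul.1
    (hdir.modEq n ⟨le_rfl, hnm.le⟩ ⟨n.le_succ, hnm⟩)
  refine mem_iUnion.2 ⟨-z, y, ?_, hdir.mono (Icc_subset_Icc_left n.le_succ)⟩
  rw [hy, zsmul_eq_mul] at hz
  push_cast
  linarith

theorem sub_lt_of_mem_corridor {n m : ℕ} (hnm : n < m) (hpos : 0 < p n)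
    (hhalf : 2 * p (n + 1) < p n) {a : ℝ} (ha : 0 < a) {t α β : ℝ} {z w : ℤ}
    (hα : |a * α + t| ≤ p n) (hβ : |a * β + t| ≤ p n)
    (hz : α ∈ corridor p (n + 1) m (a + 1) (t + 2 * p n * z))
    (hw : β ∈ corridor p (n + 1) m (a + 1) (t + 2 * p n * w)) :
    (z - w : ℝ) < 1 / a + 3 / 2 := by
  obtain ⟨-, hz⟩ := abs_le.1 (abs_le_of_mem_corridor hnm hz)
  obtain ⟨hw, -⟩ := abs_le.1 (abs_le_of_mem_corridor hnm hw)
  obtain ⟨hα, -⟩ := abs_le.1 hα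
  obtain ⟨-, hβ⟩ := abs_le.1 hβ
  have hβα : β - α ≤ 2 * p n / a := by rw [le_div_iff₀ ha]; linarith
  have hbound : 2 * p n * (z - w) < 2 * p n * (1 / a + 3 / 2) := by
    calc 2 * p n * (z - w) ≤ 2 * p (n + 1) + (a + 1) * (β - α) := by linarith
      _ ≤ 2 * p (n + 1) + (a + 1) * (2 * p n / a) := by gcongr
      _ < p n + (a + 1) * (2 * p n / a) := by gcongr
      _ = 2 * p n * (1 / a + 3 / 2) := by field_simp; ring
  exact lt_of_mul_lt_mul_left hbound (by linarith)

theorem volume_corridor_le_of_forall_le {n m : ℕ} (hnm : n < m) (hpos : 0 < p n)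
    (hhalf : 2 * p (n + 1) < p n) {a : ℝ} (ha : 1 ≤ a) (t : ℝ) {c : ℝ} (hc : 0 ≤ c)
    (h : ∀ z : ℤ, volume (corridor p (n + 1) m (a + 1) (t + 2 * p n * z)) ≤
      ENNReal.ofReal (c / (a + 1))) :
    volume (corridor p n m a t) ≤ ENNReal.ofReal (2 * c / a) := by
  obtain ⟨M, hM, hMa⟩ : ∃ M : ℕ, 1 / a + 3 / 2 ≤ M + 1 ∧ (M + 1) * a ≤ 2 * (a + 1) := by
    rcases le_total a 2 with ha2 | ha2
    · have := (div_le_one (by linarith)).2 ha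
      exact ⟨2, by push_cast; linarith, by push_cast; linarith⟩
    · have := one_div_le_one_div_of_le two_pos ha2
      exact ⟨1, by push_cast; linarith, by push_cast; linarith⟩
  calc volume (corridor p n m a t)
      ≤ volume ({α | |a * α + t| ≤ p n} ∩
          ⋃ z : ℤ, corridor p (n + 1) m (a + 1) (t + 2 * p n * z)) :=
        measure_mono (subset_inter (fun α => abs_le_of_mem_corridor hnm.le)
          (corridor_subset_iUnion hnm a t))
    _ ≤ (M + 1 : ℕ) * ENNReal.ofReal (c / (a + 1)) := by
        refine measure_inter_iUnion_int_le volume M h ?_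
        rintro z w ⟨α, hα, hz⟩ ⟨β, hβ, hw⟩
        have hzw := (sub_lt_of_mem_corridor hnm hpos hhalf (by linarith) hα hβ hz hw).trans_le hM
        exact Int.lt_add_one_iff.1 (by exact_mod_cast hzw)
    _ ≤ ENNReal.ofReal (2 * c / a) := by
        rw [← ENNReal.ofReal_natCast, ← ENNReal.ofReal_mul (by positivity)]
        refine ENNReal.ofReal_le_ofReal ?_
        rw [mul_div_assoc', div_le_div_iff₀ (by linarith) (by linarith)]
        push_cast
        linarith [mul_le_mul_of_nonneg_left hMa hc]

theorem volume_corridor_le (hpos : ∀ n, 0 < p n) (hhalf : ∀ n, 2 * p (n + 1) < p n)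
    (n j : ℕ) {a : ℝ} (ha : 1 ≤ a) (t : ℝ) :
    volume (corridor p n (n + j) a t) ≤ ENNReal.ofReal (2 ^ (j + 1) * p (n + j) / a) := by
  induction j generalizing n a t with
  | zero =>
    simpa using (measure_mono fun α => abs_le_of_mem_corridor le_rfl).trans
      (volume_abs_mul_add_le (by linarith) t (p n))
  | succ j ih =>
    have hnext : n + (j + 1) = n + 1 + j := by omega
    rw [hnext, pow_succ' 2 (j + 1), mul_assoc]
    exact volume_corridor_le_of_forall_le (by omega) (hpos n) (hhalf n) ha t
      (mul_nonneg (by positivity) (hpos _).le) fun z => ih (n + 1) (by linarith) _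

theorem volume_iInter_corridor_eq_zero (hpos : ∀ n, 0 < p n) (hhalf : ∀ n, 2 * p (n + 1) < p n)
    {n : ℕ} (hlim : Tendsto (fun j => 2 ^ j * p (n + j)) atTop (𝓝 0)) {a : ℝ} (ha : 1 ≤ a)
    (t : ℝ) : volume (⋂ j, corridor p n (n + j) a t) = 0 := by
  have hbound : Tendsto (fun j => ENNReal.ofReal (2 ^ (j + 1) * p (n + j) / a)) atTop (𝓝 0) := by
    have := ENNReal.tendsto_ofReal (hlim.const_mul (2 / a))
    rw [mul_zero, ENNReal.ofReal_zero] at this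
    refine this.congr fun j => ?_
    congr 1
    ring
  exact le_antisymm (ge_of_tendsto' hbound fun j => (measure_mono (iInter_subset _ j)).trans
    (volume_corridor_le hpos hhalf n j ha t)) zero_le

/-- The slopes `α` of the lines which start in the upper end `(k, p k)` of the aperture of level
`k` and pass directly through the apertures of the levels `k + 1, …, m`. -/
def cornerSlopes (p : ℕ → ℝ) (k m : ℕ) : Set ℝ :=
  {α | ∃ y : ℕ → ℝ, y (k + 1) ≡ p k + α [PMOD 2 * p k] ∧ IsDirectOn p α (Icc (k + 1) m) y}

theorem cornerSlopes_subset_iUnion (k m : ℕ) :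
    cornerSlopes p k m ⊆ ⋃ z : ℤ, corridor p (k + 1) m 1 ((2 * z + 1) * p k) := by
  rintro α ⟨y, hy, hdir⟩
  obtain ⟨z, hz⟩ := AddCommGroup.modEq_iff_eq_add_zsmul.1 hy
  refine mem_iUnion.2 ⟨-z, y, ?_, hdir⟩
  rw [zsmul_eq_mul] at hz
  push_cast
  linarith

theorem volume_Icc_inter_cornerSlopes_le (hpos : ∀ n, 0 < p n) (hhalf : ∀ n, 2 * p (n + 1) < p n)
    (k j : ℕ) {a b : ℝ} (hab : a ≤ b) :
    volume (Icc a b ∩ cornerSlopes p k (k + 1 + j)) ≤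
      ENNReal.ofReal (((b - a) / (2 * p k) + 2) * (2 ^ (j + 1) * p (k + 1 + j))) := by
  have hpk := hpos k
  have hx : 0 ≤ (b - a) / (2 * p k) + 1 := by
    have := sub_nonneg.2 hab
    positivity
  calc volume (Icc a b ∩ cornerSlopes p k (k + 1 + j))
      ≤ volume (Icc a b ∩ ⋃ z : ℤ, corridor p (k + 1) (k + 1 + j) 1 ((2 * z + 1) * p k)) :=
        measure_mono (inter_subset_inter_right _ (cornerSlopes_subset_iUnion k _))
    _ ≤ (⌊(b - a) / (2 * p k) + 1⌋₊ + 1 : ℕ) *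
          ENNReal.ofReal (2 ^ (j + 1) * p (k + 1 + j) / 1) := by
        refine measure_inter_iUnion_int_le volume _
          (fun z => volume_corridor_le hpos hhalf (k + 1) j le_rfl _) ?_
        rintro z w ⟨α, hα, hz⟩ ⟨β, hβ, hw⟩
        obtain ⟨-, hz⟩ := abs_le.1 (abs_le_of_mem_corridor (Nat.le_add_right _ _) hz)
        obtain ⟨hw, -⟩ := abs_le.1 (abs_le_of_mem_corridor (Nat.le_add_right _ _) hw)
        have hzw : ((z - w : ℤ) : ℝ) ≤ (b - a) / (2 * p k) + 1 := by
          rw [← sub_le_iff_le_add, le_div_iff₀ (by linarith)]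
          push_cast
          linarith [hα.1, hβ.2, hhalf k]
        rw [Int.natCast_floor_eq_floor hx]
        exact Int.le_floor.2 hzw
    _ ≤ ENNReal.ofReal (((b - a) / (2 * p k) + 2) * (2 ^ (j + 1) * p (k + 1 + j))) := by
        rw [← ENNReal.ofReal_natCast, ← ENNReal.ofReal_mul (by positivity), div_one]
        refine ENNReal.ofReal_le_ofReal (mul_le_mul_of_nonneg_right ?_
          (mul_nonneg (by positivity) (hpos _).le))
        push_cast
        linarith [Nat.floor_le hx]

theorem sum_two_mul_pow_add_le {A B : ℝ} (hA : 0 ≤ A) (hB : 0 ≤ B) (hr : 0 ≤ r) (hr' : r < 1 / 2)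
    (m : ℕ) :
    ∑ i ∈ Finset.range m, (A * (r * (2 * r) ^ i) + 4 * 2 ^ i * B) ≤
      A * (r / (1 - 2 * r)) + 4 * (2 ^ m * B) := by
  have hgeom : ∑ i ∈ Finset.range m, (2 * r) ^ i ≤ 1 / (1 - 2 * r) := by
    rw [one_div, ← tsum_geometric_of_lt_one (by linarith) (by linarith)]
    exact (summable_geometric_of_lt_one (by linarith) (by linarith)).sum_le_tsum _
      fun i _ => by positivity
  have hgeom_two : ∑ i ∈ Finset.range m, (2 : ℝ) ^ i ≤ 2 ^ m := by
    rw [geom_sum_eq (by norm_num)]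
    linarith
  calc ∑ i ∈ Finset.range m, (A * (r * (2 * r) ^ i) + 4 * 2 ^ i * B)
      = A * r * ∑ i ∈ Finset.range m, (2 * r) ^ i + 4 * B * ∑ i ∈ Finset.range m, 2 ^ i := by
        rw [Finset.sum_add_distrib, Finset.mul_sum, Finset.mul_sum]
        congr 1 <;> exact Finset.sum_congr rfl fun i _ => by ring
    _ ≤ A * r * (1 / (1 - 2 * r)) + 4 * B * 2 ^ m := by gcongr
    _ = A * (r / (1 - 2 * r)) + 4 * (2 ^ m * B) := by ring

theorem volume_Icc_inter_cornerSlopes_le_of_ratio (hpos : ∀ n, 0 < p n) (hr : r < 1 / 2)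
    (hp : ∀ n, p (n + 1) ≤ r * p n) (k i : ℕ) {a b : ℝ} (hab : a ≤ b) :
    volume (Icc a b ∩ cornerSlopes p k (k + 1 + i)) ≤
      ENNReal.ofReal ((b - a) * (r * (2 * r) ^ i) + 4 * 2 ^ i * p (k + 1 + i)) := by
  refine (volume_Icc_inter_cornerSlopes_le hpos (two_mul_lt_of_ratio hpos hr hp) k i hab).trans
    (ENNReal.ofReal_le_ofReal ?_)
  have hpk := hpos k
  have := sub_nonneg.2 hab
  have hdecay : p (k + 1 + i) ≤ r ^ (i + 1) * p k := by
    rw [add_assoc, add_comm 1]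
    exact le_ratio_pow_mul (ratio_pos hpos hp).le hp k (i + 1)
  calc ((b - a) / (2 * p k) + 2) * (2 ^ (i + 1) * p (k + 1 + i))
      = (b - a) / p k * 2 ^ i * p (k + 1 + i) + 4 * 2 ^ i * p (k + 1 + i) := by
        rw [pow_succ]; field_simp; ring
    _ ≤ (b - a) / p k * 2 ^ i * (r ^ (i + 1) * p k) + 4 * 2 ^ i * p (k + 1 + i) := by gcongr
    _ = (b - a) * (r * (2 * r) ^ i) + 4 * 2 ^ i * p (k + 1 + i) := by
        rw [pow_succ, mul_pow]; field_simp

theorem volume_Icc_inter_iUnion_cornerSlopes_le (hpos : ∀ n, 0 < p n) (hr : r < 1 / 2)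
    (hp : ∀ n, p (n + 1) ≤ r * p n) (m : ℕ) {a b : ℝ} (hab : a ≤ b) :
    volume (Icc a b ∩ ⋃ k ∈ Finset.range m, cornerSlopes p k m) ≤
      ENNReal.ofReal ((b - a) * (r / (1 - 2 * r)) + 4 * (2 ^ m * p m)) := by
  have hr0 := ratio_pos hpos hp
  have hab' := sub_nonneg.2 hab
  have hterm : ∀ i ∈ Finset.range m, volume (Icc a b ∩ cornerSlopes p (m - 1 - i) m) ≤
      ENNReal.ofReal ((b - a) * (r * (2 * r) ^ i) + 4 * 2 ^ i * p m) := by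
    intro i hi
    obtain ⟨k, rfl⟩ : ∃ k, m = k + 1 + i := ⟨m - 1 - i, by grind⟩
    rw [show k + 1 + i - 1 - i = k by omega]
    exact volume_Icc_inter_cornerSlopes_le_of_ratio hpos hr hp k i hab
  rw [inter_iUnion₂]
  calc volume (⋃ k ∈ Finset.range m, Icc a b ∩ cornerSlopes p k m)
      ≤ ∑ k ∈ Finset.range m, volume (Icc a b ∩ cornerSlopes p k m) :=
        measure_biUnion_finset_le _ _
    _ = ∑ i ∈ Finset.range m, volume (Icc a b ∩ cornerSlopes p (m - 1 - i) m) :=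
        (Finset.sum_range_reflect _ m).symm
    _ ≤ ∑ i ∈ Finset.range m, ENNReal.ofReal ((b - a) * (r * (2 * r) ^ i) + 4 * 2 ^ i * p m) :=
        Finset.sum_le_sum hterm
    _ = ENNReal.ofReal (∑ i ∈ Finset.range m, ((b - a) * (r * (2 * r) ^ i) + 4 * 2 ^ i * p m)) :=
        (ENNReal.ofReal_sum_of_nonneg fun i _ => by have := hpos m; positivity).symm
    _ ≤ ENNReal.ofReal ((b - a) * (r / (1 - 2 * r)) + 4 * (2 ^ m * p m)) :=
        ENNReal.ofReal_le_ofReal (sum_two_mul_pow_add_le hab' (hpos m).le hr0.le hr m)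

theorem ae_frequently_forall_notMem_cornerSlopes (hpos : ∀ n, 0 < p n) (hr : r < 1 / 3)
    (hp : ∀ n, p (n + 1) ≤ r * p n) :
    ∀ᵐ α : ℝ, ∃ᶠ m in atTop, ∀ k < m, α ∉ cornerSlopes p k m := by
  have hr0 := ratio_pos hpos hp
  have hnull : ∀ M : ℕ,
      volume {α : ℝ | ∀ m ≥ M, α ∈ ⋃ k ∈ Finset.range m, cornerSlopes p k m} = 0 := by
    intro M
    have hq : r / (1 - 2 * r) < 1 := by rw [div_lt_one (by linarith)]; linarith
    refine measure_eq_zero_of_forall_closedBall_le volume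
      (ENNReal.ofReal_lt_one.2 hq) fun x ρ hρ => ?_
    have hlim : Tendsto (fun m => ENNReal.ofReal ((x + ρ - (x - ρ)) * (r / (1 - 2 * r)) +
        4 * (2 ^ m * p m))) atTop (𝓝 (ENNReal.ofReal ((x + ρ - (x - ρ)) * (r / (1 - 2 * r))))) := by
      refine ENNReal.tendsto_ofReal ?_
      simpa using ((tendsto_two_pow_mul hpos (by linarith) hp 0).const_mul 4).const_add
        ((x + ρ - (x - ρ)) * (r / (1 - 2 * r)))
    rw [Real.closedBall_eq_Icc, Real.volume_Icc, mul_comm,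
      ← ENNReal.ofReal_mul (by linarith)]
    refine ge_of_tendsto hlim ?_
    filter_upwards [eventually_ge_atTop M] with m hm
    refine (measure_mono ?_).trans
      (volume_Icc_inter_iUnion_cornerSlopes_le hpos (by linarith) hp m (by linarith))
    exact fun α hα => ⟨hα.2, hα.1 m hm⟩
  filter_upwards [ae_all_iff.2 fun M => measure_eq_zero_iff_ae_notMem.1 (hnull M)] with α hα
  refine frequently_atTop.2 fun M => ?_
  obtain ⟨m, hm, hmem⟩ : ∃ m ≥ M, α ∉ ⋃ k ∈ Finset.range m, cornerSlopes p k m := by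
    simpa using hα M
  exact ⟨m, hm, fun k hk hk' => hmem (mem_biUnion (Finset.mem_coe.2 (Finset.mem_range.2 hk)) hk')⟩

end Corridor

section Wrap

theorem eq_of_modEq_of_abs_sub_lt {q x y : ℝ} (h : x ≡ y [PMOD q]) (hlt : |y - x| < q) :
    x = y := by
  obtain ⟨z, rfl⟩ := AddCommGroup.modEq_iff_eq_add_zsmul.1 h
  have hq : 0 < q := (abs_nonneg _).trans_lt hlt
  rw [add_sub_cancel_left, zsmul_eq_mul, abs_mul, abs_of_pos hq, mul_lt_iff_lt_one_left hq] at hlt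
  have hz : z = 0 := Int.abs_lt_one_iff.1 (by exact_mod_cast hlt)
  simp [hz]

/-- The representative of the height `y` in `[-h, h)`, when the horizontal sides at heights `h` and
`-h` are identified. -/
noncomputable def wrap {h : ℝ} (hh : 0 < h) (y : ℝ) : ℝ := toIcoMod (mul_pos two_pos hh) (-h) y

variable {h : ℝ} (hh : 0 < h)

theorem wrap_mem_Ico (y : ℝ) : wrap hh y ∈ Ico (-h) h := by
  simpa only [wrap, two_mul, neg_add_cancel_left] using
    toIcoMod_mem_Ico (mul_pos two_pos hh) (-h) y

theorem wrap_modEq (y : ℝ) : wrap hh y ≡ y [PMOD 2 * h] :=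
  AddCommGroup.modEq_iff_eq_add_zsmul.2
    ⟨_, (toIcoMod_add_toIcoDiv_zsmul (mul_pos two_pos hh) (-h) y).symm⟩

include hh in
theorem exists_mem_Ioc_modEq (y : ℝ) : ∃ w ∈ Ioc (-h) h, w ≡ y [PMOD 2 * h] := by
  refine ⟨toIocMod (mul_pos two_pos hh) (-h) y, ?_, ?_⟩
  · simpa only [two_mul, neg_add_cancel_left] using toIocMod_mem_Ioc (mul_pos two_pos hh) (-h) y
  · exact AddCommGroup.modEq_iff_eq_add_zsmul.2
      ⟨_, (toIocMod_add_toIocDiv_zsmul (mul_pos two_pos hh) (-h) y).symm⟩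

variable {hh}

theorem wrap_eq_iff {y w : ℝ} : wrap hh y = w ↔ w ∈ Ico (-h) h ∧ w ≡ y [PMOD 2 * h] := by
  refine ⟨?_, fun ⟨hw, hmod⟩ => ?_⟩
  · rintro rfl
    exact ⟨wrap_mem_Ico hh y, wrap_modEq hh y⟩
  · obtain ⟨hl, hu⟩ := wrap_mem_Ico hh y
    refine eq_of_modEq_of_abs_sub_lt ((wrap_modEq hh y).trans hmod.symm) (abs_lt.2 ?_)
    constructor <;> linarith [hw.1, hw.2]

theorem wrap_eq_self {y : ℝ} (hy : y ∈ Ico (-h) h) : wrap hh y = y :=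
  wrap_eq_iff.2 ⟨hy, AddCommGroup.modEq_rfl⟩

theorem wrap_congr {y y' : ℝ} (hy : y ≡ y' [PMOD 2 * h]) : wrap hh y = wrap hh y' :=
  wrap_eq_iff.2 ⟨wrap_mem_Ico hh y', (wrap_modEq hh y').trans hy.symm⟩

theorem wrap_wrap_add (y v : ℝ) : wrap hh (wrap hh y + v) = wrap hh (y + v) :=
  wrap_congr ((wrap_modEq hh y).add_right v)

theorem wrap_eq_ite {w : ℝ} (hw : w ∈ Ioc (-h) h) : wrap hh w = if w = h then -w else w := by
  split_ifs with hwh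
  · refine wrap_eq_iff.2 ⟨⟨by rw [hwh], by linarith⟩, ?_⟩
    exact AddCommGroup.modEq_iff_eq_add_zsmul.2 ⟨1, by rw [hwh, one_zsmul]; ring⟩
  · exact wrap_eq_self ⟨hw.1.le, hw.2.lt_of_ne hwh⟩

end Wrap

section Unsplit

variable {p : ℕ → ℝ} {α : ℝ} {l m : ℕ} {c : ℕ → ℝ}

/-- The lines of slope `α` through the aperture of level `m`, followed backwards, form a single
beam down to level `l`, that is, no corner of the levels `l, …, m - 1` cuts it; `c k` is the height
of the middle of the beam in the aperture of level `k`. -/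
structure IsUnsplit (p : ℕ → ℝ) (α : ℝ) (l m : ℕ) (c : ℕ → ℝ) : Prop where
  eq_zero : c m = 0
  abs_add_lt : ∀ k ∈ Ico l m, |c k| + p m < p k
  modEq : ∀ k ∈ Ico l m, c (k + 1) ≡ c k + α [PMOD 2 * p k]

theorem IsUnsplit.isDirectOn_add_const (hc : IsUnsplit p α l m c) {d : ℝ} (hd : |d| ≤ p m) :
    IsDirectOn p α (Icc l m) fun k => c k + d := by
  refine ⟨fun k ⟨hlk, hkm⟩ => ?_, fun k ⟨hlk, _⟩ ⟨_, hkm⟩ => ?_⟩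
  · rcases hkm.eq_or_lt with rfl | hkm
    · simpa only [hc.eq_zero, zero_add] using hd
    · linarith [abs_add_le (c k) d, hc.abs_add_lt k ⟨hlk, hkm⟩]
  · simpa only [add_right_comm] using (hc.modEq k ⟨hlk, hkm⟩).add_right d

theorem IsUnsplit.isDirectOn (hc : IsUnsplit p α l m c) (hm : 0 ≤ p m) :
    IsDirectOn p α (Icc l m) c := by
  simpa using hc.isDirectOn_add_const (d := 0) (by simpa using hm)

theorem IsUnsplit.mem_cornerSlopes (hc : IsUnsplit p α (l + 1) m c) {w : ℝ}
    (hw : w ∈ Ico (-p l) (p l)) (hmod : w ≡ c (l + 1) - α [PMOD 2 * p l])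
    (hcut : p l ≤ |w| + p m) : α ∈ cornerSlopes p l m := by
  obtain ⟨d, hd, hdmod⟩ : ∃ d, |d| ≤ p m ∧ w + d ≡ p l [PMOD 2 * p l] := by
    rcases le_total 0 w with h0 | h0
    · rw [abs_of_nonneg h0] at hcut
      refine ⟨p l - w, abs_le.2 ⟨by linarith [hw.2], by linarith⟩, ?_⟩
      rw [add_sub_cancel]
    · rw [abs_of_nonpos h0] at hcut
      refine ⟨-p l - w, abs_le.2 ⟨by linarith, by linarith [hw.1]⟩, ?_⟩
      exact AddCommGroup.modEq_iff_eq_add_zsmul.2 ⟨1, by rw [one_zsmul]; ring⟩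
  refine ⟨_, ?_, hc.isDirectOn_add_const hd⟩
  have hadd := (hmod.add_right (α + d)).symm.trans
    (by simpa only [add_assoc, add_comm α] using hdmod.add_right α)
  convert hadd using 1
  ring

theorem exists_isUnsplit (hpos : ∀ n, 0 < p n) (h : ∀ k < m, α ∉ cornerSlopes p k m)
    (hl : l ≤ m) : ∃ c, IsUnsplit p α l m c := by
  induction hl using Nat.decreasingInduction with
  | self => exact ⟨0, rfl, by simp, by simp⟩
  | of_succ l hl ih =>
    obtain ⟨c, hc⟩ := ih
    set w := wrap (hpos l) (c (l + 1) - α) with hw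
    obtain ⟨hwmem, hwmod⟩ := wrap_eq_iff.1 hw.symm
    have hne : ∀ k, l < k → Function.update c l w k = c k := fun k hk =>
      Function.update_of_ne hk.ne' _ _
    refine ⟨Function.update c l w, ?_, fun k ⟨hlk, hkm⟩ => ?_, fun k ⟨hlk, hkm⟩ => ?_⟩
    · rw [hne m hl, hc.eq_zero]
    · rcases hlk.eq_or_lt with rfl | hlk
      · rw [Function.update_self]
        by_contra! hcut
        exact h l hl (hc.mem_cornerSlopes hwmem hwmod hcut)
      · rw [hne k hlk]
        exact hc.abs_add_lt k ⟨hlk, hkm⟩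
    · rw [hne (k + 1) (by omega)]
      rcases hlk.eq_or_lt with rfl | hlk
      · simpa only [Function.update_self, sub_add_cancel] using (hwmod.add_right α).symm
      · rw [hne k hlk]
        exact hc.modEq k ⟨hlk, hkm⟩

theorem IsUnsplit.sub_eq (hc : IsUnsplit p α l m c) {y : ℕ → ℝ}
    (hy : IsDirectOn p α (Icc l m) y) {k : ℕ} (hlk : l ≤ k) (hkm : k ≤ m) :
    y k - c k = y m := by
  induction hkm using Nat.decreasingInduction with
  | self => rw [hc.eq_zero, sub_zero]
  | of_succ k hkm ih =>
    have hmod : y k - c k ≡ y m [PMOD 2 * p k] := by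
      rw [← ih (by omega)]
      simpa only [add_sub_add_right_eq_sub] using
        ((hy.modEq k ⟨hlk, hkm.le⟩ ⟨by omega, hkm⟩).sub (hc.modEq k ⟨hlk, hkm⟩)).symm
    refine eq_of_modEq_of_abs_sub_lt hmod ?_
    calc |y m - (y k - c k)| = |y m + c k - y k| := by ring_nf
      _ ≤ |y m| + |c k| + |y k| := (abs_sub _ _).trans (by gcongr; exact abs_add_le _ _)
      _ < 2 * p k := by
        linarith [hy.abs_le m ⟨by omega, le_rfl⟩, hy.abs_le k ⟨hlk, hkm.le⟩,
          hc.abs_add_lt k ⟨hlk, hkm⟩]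

theorem IsDirectOn.eq_of_frequently_isUnsplit (hlim : Tendsto p atTop (𝓝 0))
    (hα : ∃ᶠ m in atTop, ∃ c, IsUnsplit p α 0 m c) {y y' : ℕ → ℝ}
    (hy : IsDirectOn p α univ y) (hy' : IsDirectOn p α univ y') : y = y' := by
  funext k
  by_contra hne
  obtain ⟨m, ⟨c, hc⟩, hm, hkm⟩ := (hα.and_eventually ((hlim.eventually_lt_const
    (half_pos (abs_pos.2 (sub_ne_zero.2 hne)))).and (eventually_ge_atTop k))).exists
  have hsub : y k - y' k = y m - y' m := by
    linarith [hc.sub_eq (hy.mono (subset_univ _)) k.zero_le hkm,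
      hc.sub_eq (hy'.mono (subset_univ _)) k.zero_le hkm]
  rw [hsub] at hm
  linarith [abs_sub (y m) (y' m), hy.abs_le m (mem_univ m), hy'.abs_le m (mem_univ m)]

theorem exists_tendsto_of_isUnsplit (hpos : ∀ n, 0 < p n) (hlim : Tendsto p atTop (𝓝 0))
    {φ : ℕ → ℕ} (hφ : StrictMono φ) {c : ℕ → ℕ → ℝ} (hc : ∀ i, IsUnsplit p α 0 (φ i) (c i))
    (k : ℕ) : ∃ x, Tendsto (fun i => c i k) atTop (𝓝 x) := by
  refine cauchySeq_tendsto_of_complete (Metric.cauchySeq_iff'.2 fun ε hε => ?_)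
  obtain ⟨i, hi, hik⟩ := (((hlim.comp hφ.tendsto_atTop).eventually_lt_const hε).and
    (hφ.tendsto_atTop.eventually_ge_atTop k)).exists
  refine ⟨i, fun j hij => ?_⟩
  have hdir := (hc j).isDirectOn (hpos _).le
  have hmono := hφ.monotone hij
  rw [Real.dist_eq, (hc i).sub_eq (hdir.mono (Icc_subset_Icc_right hmono)) k.zero_le hik]
  exact (hdir.abs_le _ ⟨Nat.zero_le _, hmono⟩).trans_lt hi

theorem exists_isDirectOn_univ (hpos : ∀ n, 0 < p n) (hlim : Tendsto p atTop (𝓝 0))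
    (hα : ∃ᶠ m in atTop, ∃ c, IsUnsplit p α 0 m c) :
    ∃ y, IsDirectOn p α univ y ∧ ∀ k, |y k| < p k := by
  obtain ⟨φ, hφ, hunsplit⟩ := extraction_of_frequently_atTop hα
  choose c hc using hunsplit
  choose y hy using exists_tendsto_of_isUnsplit hpos hlim hφ hc
  have hdir : ∀ i j, i ≤ j → IsDirectOn p α (Icc 0 (φ i)) (c j) := fun i j hij =>
    ((hc j).isDirectOn (hpos _).le).mono (Icc_subset_Icc_right (hφ.monotone hij))
  have habs : ∀ i, |y (φ i)| ≤ p (φ i) := fun i => by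
    refine le_of_tendsto (hy (φ i)).abs ?_
    filter_upwards [eventually_ge_atTop i] with j hij
    exact (hdir i j hij).abs_le _ ⟨Nat.zero_le _, le_rfl⟩
  have hshift : ∀ i, ∀ k ≤ φ i, y k = c i k + y (φ i) := fun i k hk => by
    refine eq_add_of_sub_eq' (tendsto_nhds_unique ((hy k).sub_const (c i k)) ((hy (φ i)).congr' ?_))
    filter_upwards [eventually_ge_atTop i] with j hij
    exact ((hc i).sub_eq (hdir i j hij) k.zero_le hk).symm
  have hlt : ∀ k, ∃ i, k < φ i := fun k => (hφ.tendsto_atTop.eventually_gt_atTop k).exists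
  have hstrict : ∀ k, |y k| < p k := fun k => by
    obtain ⟨i, hi⟩ := hlt k
    rw [hshift i k hi.le]
    linarith [abs_add_le (c i k) (y (φ i)), habs i, (hc i).abs_add_lt k ⟨k.zero_le, hi⟩]
  refine ⟨y, ⟨fun k _ => (hstrict k).le, fun k _ _ => ?_⟩, hstrict⟩
  obtain ⟨i, hi⟩ := hlt k
  rw [hshift i k hi.le, hshift i (k + 1) hi]
  exact ((hc i).isDirectOn_add_const (habs i)).modEq k ⟨k.zero_le, hi.le⟩ ⟨Nat.zero_le _, hi⟩

end Unsplit

section ReturnMap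

variable {p : ℕ → ℝ} (hpos : ∀ n, 0 < p n) (α : ℝ)

include hpos in
theorem halfHeight_pos (k : ℤ) : 0 < halfHeight p k := by
  cases k <;> exact hpos _

theorem halfHeight_neg_add_one (p : ℕ → ℝ) (k : ℤ) :
    halfHeight p (-(k + 1)) = halfHeight p k := by
  cases k with
  | ofNat n => rfl
  | negSucc n =>
    rw [show -(Int.negSucc n + 1) = Int.ofNat n by simp [Int.negSucc_eq]]
    rfl

/-- The heights that occur over the strip `k ≤ X < k + 1` of the surface. -/
abbrev stripHeights (p : ℕ → ℝ) (k : ℤ) : Set ℝ := Ico (-halfHeight p k) (halfHeight p k)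

theorem stripHeights_neg_add_one (p : ℕ → ℝ) (k : ℤ) :
    stripHeights p (-(k + 1)) = stripHeights p k := by
  rw [stripHeights, halfHeight_neg_add_one]

/-- The points `(k, y)` of the surface with integer abscissa, which form a cross section of the
flow; such a point is where the crossing of the strip `k ≤ X < k + 1` begins. -/
abbrev CrossSection (p : ℕ → ℝ) : Type := {s : ℤ × ℝ // s.2 ∈ stripHeights p s.1}

/-- The vertical displacement of a point during the crossing of a strip in a direction of
slope `α`. -/
noncomputable def rotate : Equiv.Perm (CrossSection p) where
  toFun s := ⟨(s.1.1, wrap (halfHeight_pos hpos s.1.1) (s.1.2 + α)),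
    wrap_mem_Ico (halfHeight_pos hpos _) _⟩
  invFun s := ⟨(s.1.1, wrap (halfHeight_pos hpos s.1.1) (s.1.2 - α)),
    wrap_mem_Ico (halfHeight_pos hpos _) _⟩
  left_inv s := Subtype.ext <| Prod.ext rfl <| by
    simp only [sub_eq_add_neg, wrap_wrap_add, add_neg_cancel_right, wrap_eq_self s.2]
  right_inv s := Subtype.ext <| Prod.ext rfl <| by
    simp only [sub_eq_add_neg, wrap_wrap_add, neg_add_cancel_right, wrap_eq_self s.2]

open Classical in
/-- The passage from the right end of the strip `k ≤ X < k + 1` to the next strip: the particle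
either goes through the aperture at `X = k + 1`, or is moved to the mirror wall
`X = -(k + 1)`. -/
noncomputable def crossLine (p : ℕ → ℝ) : Equiv.Perm (CrossSection p) where
  toFun s :=
    if h : s.1.2 ∈ stripHeights p (s.1.1 + 1) then ⟨(s.1.1 + 1, s.1.2), h⟩
    else ⟨(-(s.1.1 + 1), s.1.2), (stripHeights_neg_add_one p s.1.1).symm ▸ s.2⟩
  invFun s :=
    if h : s.1.2 ∈ stripHeights p (s.1.1 - 1) then ⟨(s.1.1 - 1, s.1.2), h⟩
    else ⟨(-(s.1.1 + 1), s.1.2), (stripHeights_neg_add_one p s.1.1).symm ▸ s.2⟩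
  left_inv := by
    rintro ⟨⟨k, y⟩, hy⟩
    by_cases h : y ∈ stripHeights p (k + 1)
    · simp [h, hy]
    · have h' : y ∉ stripHeights p (-(k + 1) - 1) := by
        rwa [show -(k + 1) - 1 = -(k + 1 + 1) by ring, stripHeights_neg_add_one]
      simp only [h, h', dite_false]
      simp
  right_inv := by
    rintro ⟨⟨k, y⟩, hy⟩
    by_cases h : y ∈ stripHeights p (k - 1)
    · simp [h, hy]
    · have h' : y ∉ stripHeights p (-(k + 1) + 1) := by
        rwa [show -(k + 1) + 1 = -(k - 1 + 1) by ring, stripHeights_neg_add_one]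
      simp only [h, h', dite_false]
      simp

/-- The first return map of the flow of slope `α` to the lines of integer abscissa. -/
noncomputable def returnMap : Equiv.Perm (CrossSection p) := crossLine p * rotate hpos α

open Classical in
theorem coe_returnMap (s : CrossSection p) :
    (returnMap hpos α s).1 = (
      if wrap (halfHeight_pos hpos s.1.1) (s.1.2 + α) ∈ stripHeights p (s.1.1 + 1)
      then s.1.1 + 1 else -(s.1.1 + 1),
      wrap (halfHeight_pos hpos s.1.1) (s.1.2 + α)) := by
  change (crossLine p (rotate hpos α s)).1 = _
  rw [crossLine, Equiv.coe_fn_mk]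
  split_ifs with h h' h' <;> first | rfl | contradiction

end ReturnMap

section Flow

variable {p : ℕ → ℝ} (hpos : ∀ n, 0 < p n) {α θ : ℝ} (s : CrossSection p)

/-- The position of the particle that begins the crossing of a strip at `s` with slope `α`, when it
has covered the horizontal distance `u`. -/
noncomputable def glide (α u : ℝ) : ℝ × ℝ :=
  (s.1.1 + u, wrap (halfHeight_pos hpos s.1.1) (s.1.2 + u * α))

/-- The billiard flow of direction `θ`: the position at time `t` of the particle that is at `s` at
time `0`. -/
noncomputable def flow (θ t : ℝ) : ℝ × ℝ :=
  glide hpos ((returnMap hpos (Real.tan θ) ^ ⌊t * Real.cos θ⌋) s) (Real.tan θ)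
    (Int.fract (t * Real.cos θ))

variable {s}

theorem glide_zero : glide hpos s α 0 = ((s.1.1 : ℝ), s.1.2) := by
  rw [glide, add_zero, zero_mul, add_zero, wrap_eq_self s.2]

theorem glide_sub {u v w : ℝ} (hw : w ≡ s.1.2 + u * α [PMOD 2 * halfHeight p s.1.1])
    (hv : w - v * α ∈ stripHeights p s.1.1) :
    glide hpos s α (u - v) = ((s.1.1 : ℝ) + u, w) - v • (1, α) := by
  have hwrap : wrap (halfHeight_pos hpos s.1.1) (s.1.2 + (u - v) * α) = w - v * α := by
    refine wrap_eq_iff.2 ⟨hv, ?_⟩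
    simpa only [sub_mul, add_sub_assoc] using hw.sub_right (v * α)
  rw [glide, hwrap, Prod.smul_mk, Prod.mk_sub_mk, smul_eq_mul, smul_eq_mul, mul_one, add_sub_assoc]

theorem smul_direction (hc : 0 < Real.cos θ) (r : ℝ) :
    r • direction θ = (r * Real.cos θ) • (1, Real.tan θ) := by
  simp only [direction, Prod.smul_mk, smul_eq_mul, mul_one, mul_assoc, mul_comm (Real.cos θ),
    Real.tan_mul_cos hc.ne']

theorem flow_eq_glide {t u : ℝ} {N : ℤ} (h : t * Real.cos θ = N + u) (hu : u ∈ Ico (0 : ℝ) 1) :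
    flow hpos s θ t = glide hpos ((returnMap hpos (Real.tan θ) ^ N) s) (Real.tan θ) u := by
  have hN : ⌊t * Real.cos θ⌋ = N :=
    Int.floor_eq_iff.2 ⟨by linarith [hu.1], by linarith [hu.2]⟩
  rw [flow, Int.fract, hN, h, add_sub_cancel_left]

theorem flow_zpow (hc : 0 < Real.cos θ) (N : ℤ) (t : ℝ) :
    flow hpos ((returnMap hpos (Real.tan θ) ^ N) s) θ t =
      flow hpos s θ (t + N / Real.cos θ) := by
  have h : (t + N / Real.cos θ) * Real.cos θ = ((⌊t * Real.cos θ⌋ + N : ℤ) : ℝ) +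
      Int.fract (t * Real.cos θ) := by
    rw [add_mul, div_mul_cancel₀ _ hc.ne', Int.cast_add, add_right_comm, Int.floor_add_fract]
  rw [flow_eq_glide hpos h ⟨Int.fract_nonneg _, Int.fract_lt_one _⟩, flow, zpow_add,
    Equiv.Perm.mul_apply]

theorem floor_intCast_add {u : ℝ} (k : ℤ) (hu : u ∈ Ico (0 : ℝ) 1) : ⌊(k : ℝ) + u⌋ = k := by
  rw [Int.floor_intCast_add, Int.floor_eq_zero_iff.2 hu, add_zero]

theorem ceil_intCast_add {u : ℝ} (k : ℤ) (hu : u ∈ Ioc (0 : ℝ) 1) : ⌈(k : ℝ) + u⌉ = k + 1 := by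
  rw [Int.ceil_intCast_add, add_right_inj, Int.ceil_eq_iff]
  simpa using hu

theorem glide_mem_surface {u : ℝ} (hu : u ∈ Ico (0 : ℝ) 1) : glide hpos s α u ∈ surface p := by
  rw [surface, mem_ofPred_eq, glide]
  dsimp only
  rw [floor_intCast_add _ hu]
  exact wrap_mem_Ico (halfHeight_pos hpos _) _

theorem flow_mem_surface (t : ℝ) : flow hpos s θ t ∈ surface p :=
  glide_mem_surface hpos ⟨Int.fract_nonneg _, Int.fract_lt_one _⟩

theorem exists_flow_add (hc : 0 < Real.cos θ) (hs : 0 < Real.sin θ) (t : ℝ) :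
    ∃ ε > 0, ∀ r, 0 ≤ r → r < ε → flow hpos s θ (t + r) = flow hpos s θ t + r • direction θ := by
  obtain ⟨N, u, hu, htu⟩ : ∃ N : ℤ, ∃ u ∈ Ico (0 : ℝ) 1, t * Real.cos θ = N + u :=
    ⟨_, _, ⟨Int.fract_nonneg _, Int.fract_lt_one _⟩, (Int.floor_add_fract _).symm⟩
  set σ := (returnMap hpos (Real.tan θ) ^ N) s with hσ
  set Y := wrap (halfHeight_pos hpos σ.1.1) (σ.1.2 + u * Real.tan θ) with hY
  obtain ⟨hYmem, hYmod⟩ := wrap_eq_iff.1 hY.symm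
  have hu1 : 0 < 1 - u := sub_pos.2 hu.2
  have hYtop : 0 < halfHeight p σ.1.1 - Y := sub_pos.2 hYmem.2
  refine ⟨min ((1 - u) / Real.cos θ) ((halfHeight p σ.1.1 - Y) / Real.sin θ), by positivity,
    fun r hr0 hr => ?_⟩
  rw [lt_min_iff, lt_div_iff₀ hc, lt_div_iff₀ hs] at hr
  have hrc : 0 ≤ r * Real.cos θ := by positivity
  have hrs : 0 ≤ r * Real.sin θ := by positivity
  have htan : r * Real.cos θ * Real.tan θ = r * Real.sin θ := by
    rw [mul_assoc, mul_comm (Real.cos θ), Real.tan_mul_cos hc.ne']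
  rw [flow_eq_glide hpos (t := t + r) (u := u - -(r * Real.cos θ)) (N := N) (by linarith)
    ⟨by linarith [hu.1], by linarith⟩, flow_eq_glide hpos htu hu, ← hσ,
    glide_sub hpos hYmod, smul_direction hc, neg_smul, sub_neg_eq_add]
  · rfl
  · rw [neg_mul, htan]
    exact ⟨by linarith [hYmem.1], by linarith⟩

/-- The points at which segments that travel up and to the right on the surface can arrive; these
are the points to which the side identifications apply. -/
def arrivals (p : ℕ → ℝ) : Set (ℝ × ℝ) :=
  {e | e.2 ∈ Ioc (-halfHeight p (⌈e.1⌉ - 1)) (halfHeight p (⌈e.1⌉ - 1))}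

open Classical in
theorem glue_of_mem_arrivals {e : ℝ × ℝ} (he : e ∈ arrivals p) {k : ℤ} (hk : ⌈e.1⌉ - 1 = k) :
    glue p e = (
      if wrap (halfHeight_pos hpos k) e.2 ∈ stripHeights p ⌊e.1⌋ then e.1 else -e.1,
      wrap (halfHeight_pos hpos k) e.2) := by
  subst hk
  rw [glue, ← wrap_eq_ite (hh := halfHeight_pos hpos _) he]
  simp only [stripHeights, mem_Ico]
  split_ifs <;> rfl

theorem flow_eq_glue {t u w : ℝ} {N : ℤ} {σ : CrossSection p}
    (hσ : (returnMap hpos (Real.tan θ) ^ N) s = σ) (h : t * Real.cos θ = N + u)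
    (hu : u ∈ Ioc (0 : ℝ) 1) (hw : w ∈ Ioc (-halfHeight p σ.1.1) (halfHeight p σ.1.1))
    (hmod : w ≡ σ.1.2 + u * Real.tan θ [PMOD 2 * halfHeight p σ.1.1]) :
    flow hpos s θ t = glue p ((σ.1.1 : ℝ) + u, w) := by
  have hceil : ⌈(σ.1.1 : ℝ) + u⌉ - 1 = σ.1.1 := by rw [ceil_intCast_add _ hu, add_sub_cancel_right]
  rw [glue_of_mem_arrivals hpos (by rwa [arrivals, mem_ofPred_eq, hceil]) hceil, wrap_congr hmod]
  rcases hu.2.eq_or_lt with rfl | hu1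
  · have hN : t * Real.cos θ = ((1 + N : ℤ) : ℝ) + 0 := by push_cast; linarith
    have hfloor : ⌊(σ.1.1 : ℝ) + 1⌋ = σ.1.1 + 1 := by simp
    rw [flow_eq_glide hpos hN ⟨le_rfl, one_pos⟩, zpow_add, zpow_one, Equiv.Perm.mul_apply, hσ,
      glide_zero, coe_returnMap, hfloor, one_mul]
    split_ifs <;> simp
  · have hu' : u ∈ Ico (0 : ℝ) 1 := ⟨hu.1.le, hu1⟩
    rw [floor_intCast_add _ hu', if_pos (wrap_mem_Ico _ _), flow_eq_glide hpos h hu', hσ, glide]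

theorem exists_flow_sub (hc : 0 < Real.cos θ) (hs : 0 < Real.sin θ) (t : ℝ) :
    ∃ ε > 0, ∃ e, (∀ r, 0 < r → r < ε → flow hpos s θ (t - r) = e - r • direction θ) ∧
      flow hpos s θ t = glue p e := by
  obtain ⟨N, u, hu, htu⟩ : ∃ N : ℤ, ∃ u ∈ Ioc (0 : ℝ) 1, t * Real.cos θ = N + u := by
    refine ⟨⌈t * Real.cos θ⌉ - 1, t * Real.cos θ - (⌈t * Real.cos θ⌉ - 1), ⟨?_, ?_⟩, ?_⟩
    · linarith [Int.ceil_lt_add_one (t * Real.cos θ)]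
    · linarith [Int.le_ceil (t * Real.cos θ)]
    · push_cast
      ring
  obtain ⟨σ, hσ⟩ : ∃ σ, (returnMap hpos (Real.tan θ) ^ N) s = σ := ⟨_, rfl⟩
  obtain ⟨w, hw, hmod⟩ := exists_mem_Ioc_modEq (halfHeight_pos hpos σ.1.1)
    (σ.1.2 + u * Real.tan θ)
  have hbottom : 0 < w + halfHeight p σ.1.1 := by linarith [hw.1]
  have hu0 := hu.1
  refine ⟨min (u / Real.cos θ) ((w + halfHeight p σ.1.1) / Real.sin θ), by positivity,
    (σ.1.1 + u, w), fun r hr0 hr => ?_, flow_eq_glue hpos hσ htu hu hw hmod⟩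
  rw [lt_min_iff, lt_div_iff₀ hc, lt_div_iff₀ hs] at hr
  have hrc : 0 < r * Real.cos θ := by positivity
  have hrs : 0 < r * Real.sin θ := by positivity
  have htan : r * Real.cos θ * Real.tan θ = r * Real.sin θ := by
    rw [mul_assoc, mul_comm (Real.cos θ), Real.tan_mul_cos hc.ne']
  rw [flow_eq_glide hpos (u := u - r * Real.cos θ) (N := N) (by linarith)
    ⟨by linarith, by linarith [hu.2]⟩, hσ, glide_sub hpos hmod, smul_direction hc]
  rw [htan]
  exact ⟨by linarith, by linarith [hw.2]⟩

theorem isTrajectory_flow (hc : 0 < Real.cos θ) (hs : 0 < Real.sin θ) :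
    IsTrajectory p θ (flow hpos s θ) := fun t =>
  ⟨flow_mem_surface hpos t, exists_flow_add hpos hc hs t, exists_flow_sub hpos hc hs t⟩

end Flow

section Determinism

variable {p : ℕ → ℝ} (hpos : ∀ n, 0 < p n) {θ : ℝ} {γ : ℝ → ℝ × ℝ}

theorem wrap_injOn {h : ℝ} (hh : 0 < h) : InjOn (wrap hh) (Ioc (-h) h) := by
  intro w hw w' hw' heq
  refine eq_of_modEq_of_abs_sub_lt
    ((wrap_modEq hh w).symm.trans (heq ▸ wrap_modEq hh w')) (abs_lt.2 ⟨?_, ?_⟩) <;>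
  linarith [hw.1, hw.2, hw'.1, hw'.2]

theorem stripHeights_ceil_neg_sub_one (x : ℝ) :
    stripHeights p (⌈-x⌉ - 1) = stripHeights p ⌊x⌋ := by
  rw [Int.ceil_neg, show -⌊x⌋ - 1 = -(⌊x⌋ + 1) by ring, stripHeights_neg_add_one]

include hpos

theorem glue_injOn : InjOn (glue p) (arrivals p) := by
  rintro ⟨x, y⟩ he ⟨x', y'⟩ he' heq
  rw [glue_of_mem_arrivals hpos he rfl, glue_of_mem_arrivals hpos he' rfl, Prod.mk.injEq] at heq
  obtain ⟨hx, hy⟩ := heq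
  have hmem := wrap_mem_Ico (halfHeight_pos hpos (⌈x⌉ - 1)) y
  have hmem' := wrap_mem_Ico (halfHeight_pos hpos (⌈x'⌉ - 1)) y'
  have heq_of_fst : x = x' → (x, y) = (x', y') := by
    rintro rfl
    exact congrArg (Prod.mk x) (wrap_injOn _ he he' hy)
  dsimp only at hx hy
  split_ifs at hx with hc hc' hc'
  · exact heq_of_fst hx
  · refine absurd ?_ hc'
    rwa [← stripHeights_ceil_neg_sub_one, ← hx, ← hy]
  · refine absurd ?_ hc
    rwa [← stripHeights_ceil_neg_sub_one, hx, hy]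
  · exact heq_of_fst (neg_injective hx)

omit hpos in
theorem mem_arrivals (hc : 0 < Real.cos θ) (hs : 0 < Real.sin θ) {e : ℝ × ℝ} {ε : ℝ} (hε : 0 < ε)
    (h : ∀ r, 0 < r → r < ε → e - r • direction θ ∈ surface p) : e ∈ arrivals p := by
  have hceil : 0 < e.1 + 1 - ⌈e.1⌉ := by linarith [Int.ceil_lt_add_one e.1]
  have hstrip : ∀ᶠ r in 𝓝[>] 0, e.2 - r * Real.sin θ ∈ stripHeights p (⌈e.1⌉ - 1) := by
    filter_upwards [Ioo_mem_nhdsGT hε, Ioo_mem_nhdsGT (div_pos hceil hc)] with r ⟨hr0, hrε⟩ ⟨_, hr⟩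
    rw [lt_div_iff₀ hc] at hr
    have hfloor : ⌊e.1 - r * Real.cos θ⌋ = ⌈e.1⌉ - 1 := by
      rw [Int.floor_eq_iff]
      push_cast
      constructor <;> linarith [Int.le_ceil e.1, mul_pos hr0 hc]
    have hmem := h r hr0 hrε
    simpa [surface, direction, hfloor] using hmem
  have hlim : Tendsto (fun r => e.2 - r * Real.sin θ) (𝓝[>] 0) (𝓝 e.2) :=
    tendsto_nhdsWithin_of_tendsto_nhds
      (Continuous.tendsto' (by fun_prop) _ _ (by rw [zero_mul, sub_zero]))
  refine ⟨?_, le_of_tendsto hlim (hstrip.mono fun r hr => hr.2.le)⟩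
  obtain ⟨r, hr, hr0⟩ := (hstrip.and self_mem_nhdsWithin).exists
  linarith [hr.1, mul_pos (show 0 < r from hr0) hs]

theorem IsTrajectory.eventually_eq_iff (hc : 0 < Real.cos θ) (hs : 0 < Real.sin θ)
    (h : IsTrajectory p θ γ) {γ' : ℝ → ℝ × ℝ} (h' : IsTrajectory p θ γ') (t : ℝ) :
    ∀ᶠ r in 𝓝 t, (γ r = γ' r ↔ γ t = γ' t) := by
  obtain ⟨-, ⟨ε, hε, hnext⟩, δ, hδ, e, hprev, hglue⟩ := h t
  obtain ⟨-, ⟨ε', hε', hnext'⟩, δ', hδ', e', hprev', hglue'⟩ := h' t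
  have he : e ∈ arrivals p := mem_arrivals hc hs hδ fun r h0 hr => hprev r h0 hr ▸ (h (t - r)).1
  have he' : e' ∈ arrivals p :=
    mem_arrivals hc hs hδ' fun r h0 hr => hprev' r h0 hr ▸ (h' (t - r)).1
  filter_upwards [Ioo_mem_nhds (sub_lt_self t (lt_min hδ hδ'))
    (lt_add_of_pos_right t (lt_min hε hε'))] with r ⟨hr, hr'⟩
  rcases le_or_gt t r with htr | htr
  · obtain ⟨v, rfl⟩ : ∃ v, r = t + v := ⟨r - t, by ring⟩
    rw [add_lt_add_iff_left, lt_min_iff] at hr'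
    rw [hnext v (by linarith) hr'.1, hnext' v (by linarith) hr'.2, add_left_inj]
  · obtain ⟨v, rfl⟩ : ∃ v, r = t - v := ⟨t - r, by ring⟩
    rw [sub_lt_sub_iff_left, lt_min_iff] at hr
    rw [hprev v (by linarith) hr.1, hprev' v (by linarith) hr.2, sub_left_inj, hglue, hglue',
      (glue_injOn hpos).eq_iff he he']

theorem IsTrajectory.eq_of_apply_eq (hc : 0 < Real.cos θ) (hs : 0 < Real.sin θ)
    (h : IsTrajectory p θ γ) {γ' : ℝ → ℝ × ℝ} (h' : IsTrajectory p θ γ') {t₀ : ℝ}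
    (h₀ : γ t₀ = γ' t₀) : γ = γ' := by
  have hloc : IsLocallyConstant fun t => γ t = γ' t :=
    IsLocallyConstant.iff_eventually_eq _ |>.2 fun t =>
      (h.eventually_eq_iff hpos hc hs h' t).mono fun _ => propext
  funext t
  exact (hloc.apply_eq_of_preconnectedSpace t t₀).mpr h₀

omit hpos in
theorem IsTrajectory.comp_add (h : IsTrajectory p θ γ) (c : ℝ) :
    IsTrajectory p θ fun t => γ (t + c) := by
  intro t
  obtain ⟨hmem, ⟨ε, hε, hnext⟩, δ, hδ, e, hprev, hglue⟩ := h (t + c)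
  refine ⟨hmem, ⟨ε, hε, fun r h0 hr => ?_⟩, δ, hδ, e, fun r h0 hr => ?_, hglue⟩
  · simpa only [add_right_comm] using hnext r h0 hr
  · simpa only [sub_add_eq_add_sub] using hprev r h0 hr

theorem exists_glide_eq (α : ℝ) {z : ℝ × ℝ} (hz : z ∈ surface p) :
    ∃ s : CrossSection p, glide hpos s α (Int.fract z.1) = z := by
  refine ⟨⟨(⌊z.1⌋, wrap (halfHeight_pos hpos ⌊z.1⌋) (z.2 - Int.fract z.1 * α)),
    wrap_mem_Ico (halfHeight_pos hpos _) _⟩, Prod.ext (Int.floor_add_fract z.1) ?_⟩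
  simp only [glide, wrap_wrap_add, sub_add_cancel]
  exact wrap_eq_self hz

theorem IsTrajectory.exists_eq_flow (hc : 0 < Real.cos θ) (hs : 0 < Real.sin θ)
    (h : IsTrajectory p θ γ) :
    ∃ (s : CrossSection p) (c : ℝ), γ = fun t => flow hpos s θ (t + c) := by
  obtain ⟨s, hs0⟩ := exists_glide_eq hpos (Real.tan θ) (h 0).1
  refine ⟨s, Int.fract (γ 0).1 / Real.cos θ, h.eq_of_apply_eq hpos hc hs
    ((isTrajectory_flow hpos hc hs).comp_add _) (t₀ := 0) ?_⟩
  rw [flow_eq_glide hpos (N := 0) (u := Int.fract (γ 0).1)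
    (by rw [zero_add, div_mul_cancel₀ _ hc.ne', Int.cast_zero, zero_add])
    ⟨Int.fract_nonneg _, Int.fract_lt_one _⟩, zpow_zero, Equiv.Perm.one_apply, hs0]

end Determinism

section Itinerary

variable {k : ℤ → ℤ} (hk : ∀ N, k (N + 1) = k N + 1 ∨ (0 ≤ k N ∧ k (N + 1) = -(k N + 1)))

include hk

theorem exists_ge_eq_zero_of_nonpos {N : ℤ} (hN : k N ≤ 0) : ∃ M ≥ N, k M = 0 := by
  obtain ⟨n, hn⟩ := Int.exists_eq_neg_ofNat hN
  induction n generalizing N with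
  | zero => exact ⟨N, le_rfl, by simpa using hn⟩
  | succ n ih =>
    obtain ⟨M, hM, hM0⟩ := ih (N := N + 1) (by have := hk N; omega) (by have := hk N; omega)
    exact ⟨M, by omega, hM0⟩

theorem exists_eq_zero_of_nonneg {N : ℤ} (hN : 0 ≤ k N) : ∃ M, k M = 0 := by
  obtain ⟨n, hn⟩ := Int.eq_ofNat_of_zero_le hN
  induction n generalizing N with
  | zero => exact ⟨N, hn⟩
  | succ n ih =>
    have hprev := hk (N - 1)
    rw [sub_add_cancel] at hprev
    exact ih (N := N - 1) (by omega) (by omega)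

theorem exists_forall_add_natCast_eq (hne : ∀ᶠ N in atTop, k N ≠ 0) :
    ∃ N, ∀ j : ℕ, k (N + j) = j := by
  obtain ⟨B, hB⟩ := eventually_atTop.1 hne
  have hzero : ∃ M, k M = 0 := (le_total (k 0) 0).elim
    (fun h => (exists_ge_eq_zero_of_nonpos hk h).imp fun _ => And.right)
    (exists_eq_zero_of_nonneg hk)
  obtain ⟨N, hN, hlast⟩ := Int.exists_greatest_of_bdd (P := fun M => k M = 0)
    ⟨B, fun M hM => (lt_of_not_ge fun h => hB M h hM).le⟩ hzero
  have hpos : ∀ M, N < M → 0 < k M := fun M hM => by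
    by_contra! hle
    obtain ⟨M', hM', h0⟩ := exists_ge_eq_zero_of_nonpos hk hle
    exact (hM.trans_le hM').not_ge (hlast M' h0)
  refine ⟨N, fun j => ?_⟩
  induction j with
  | zero => simpa using hN
  | succ j ih =>
    have hstep := hk (N + j)
    have hnext := hpos (N + j + 1) (by omega)
    push_cast
    rw [← add_assoc]
    omega

end Itinerary

section Escape

variable {p : ℕ → ℝ} {hpos : ∀ n, 0 < p n} {α θ : ℝ} {s : CrossSection p}

theorem stripHeights_subset_add_one (hanti : Antitone p) {k : ℤ} (hk : k < 0) :
    stripHeights p k ⊆ stripHeights p (k + 1) := by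
  have hle : halfHeight p k ≤ halfHeight p (k + 1) := by
    obtain ⟨n, rfl⟩ := Int.eq_negSucc_of_lt_zero hk
    cases n with
    | zero => exact le_rfl
    | succ n => exact hanti n.le_succ
  exact Ico_subset_Ico (neg_le_neg hle) hle

theorem returnMap_fst (hanti : Antitone p) :
    (returnMap hpos α s).1.1 = s.1.1 + 1 ∨
      (0 ≤ s.1.1 ∧ (returnMap hpos α s).1.1 = -(s.1.1 + 1)) := by
  rw [coe_returnMap]
  dsimp only
  split_ifs with h
  · exact Or.inl rfl
  · refine Or.inr ⟨le_of_not_gt fun hneg => h ?_, rfl⟩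
    exact stripHeights_subset_add_one hanti hneg (wrap_mem_Ico _ _)

theorem returnMap_zpow_add_one (N : ℤ) :
    (returnMap hpos α ^ (N + 1)) s = returnMap hpos α ((returnMap hpos α ^ N) s) := by
  rw [add_comm, zpow_add, zpow_one, Equiv.Perm.mul_apply]

theorem flow_intCast_div_cos (hc : 0 < Real.cos θ) (N : ℤ) :
    flow hpos s θ (N / Real.cos θ) = ((((returnMap hpos (Real.tan θ) ^ N) s).1.1 : ℝ),
      ((returnMap hpos (Real.tan θ) ^ N) s).1.2) := by
  rw [flow_eq_glide hpos (u := 0) (N := N) (by rw [div_mul_cancel₀ _ hc.ne', add_zero])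
    ⟨le_rfl, one_pos⟩, glide_zero]

theorem range_flow_zpow (hc : 0 < Real.cos θ) (N : ℤ) :
    range (flow hpos ((returnMap hpos (Real.tan θ) ^ N) s) θ) = range (flow hpos s θ) := by
  rw [show flow hpos ((returnMap hpos (Real.tan θ) ^ N) s) θ =
    flow hpos s θ ∘ Equiv.addRight (N / Real.cos θ) from funext (flow_zpow hpos hc N),
    (Equiv.surjective _).range_comp]

/-- The particle that starts at `s` in a direction of slope `α` crosses the strips
`0 ≤ X < 1`, `1 ≤ X < 2`, … one after the other, without ever being reflected by a vertical wall. -/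
def EscapesDirectly (hpos : ∀ n, 0 < p n) (α : ℝ) (s : CrossSection p) : Prop :=
  ∀ j : ℕ, ((returnMap hpos α ^ (j : ℤ)) s).1.1 = j

theorem exists_escapesDirectly_zpow (hanti : Antitone p) (hc : 0 < Real.cos θ)
    (h : Tendsto (fun t => (fold (flow hpos s θ t)).1) atTop atTop) :
    ∃ N : ℤ, EscapesDirectly hpos (Real.tan θ) ((returnMap hpos (Real.tan θ) ^ N) s) := by
  let k (N : ℤ) : ℤ := ((returnMap hpos (Real.tan θ) ^ N) s).1.1
  have hstep : ∀ N, k (N + 1) = k N + 1 ∨ (0 ≤ k N ∧ k (N + 1) = -(k N + 1)) := fun N => by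
    simp only [k, returnMap_zpow_add_one]
    exact returnMap_fst hanti
  have hne : ∀ᶠ N in atTop, k N ≠ 0 := by
    have hlim := h.comp ((tendsto_intCast_atTop_atTop (R := ℝ)).atTop_div_const hc)
    filter_upwards [hlim.eventually_gt_atTop 0] with N hN h0
    rw [Function.comp_apply, flow_intCast_div_cos hc] at hN
    exact (abs_pos.1 hN) (Int.cast_eq_zero.2 h0)
  obtain ⟨N, hN⟩ := exists_forall_add_natCast_eq hstep hne
  refine ⟨N, fun j => ?_⟩
  rw [← Equiv.Perm.mul_apply, ← zpow_add, add_comm]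
  exact hN j

theorem EscapesDirectly.isDirectOn (h : EscapesDirectly hpos α s) :
    IsDirectOn p α univ fun j => ((returnMap hpos α ^ (j : ℤ)) s).1.2 := by
  have hj : ∀ j : ℕ, halfHeight p ((returnMap hpos α ^ (j : ℤ)) s).1.1 = p j := fun j => by
    rw [h j]
    rfl
  refine ⟨fun j _ => ?_, fun j _ _ => ?_⟩
  · have hmem := ((returnMap hpos α ^ (j : ℤ)) s).2
    rw [stripHeights, hj] at hmem
    exact abs_le.2 ⟨hmem.1, hmem.2.le⟩
  · rw [Nat.cast_succ, returnMap_zpow_add_one, coe_returnMap, ← hj]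
    exact wrap_modEq (halfHeight_pos hpos _) _

theorem EscapesDirectly.eq_of_frequently_isUnsplit (hlim : Tendsto p atTop (𝓝 0))
    (hα : ∃ᶠ m in atTop, ∃ c, IsUnsplit p α 0 m c) {s' : CrossSection p}
    (h : EscapesDirectly hpos α s) (h' : EscapesDirectly hpos α s') : s = s' :=
  Subtype.ext <| Prod.ext ((h 0).trans (h' 0).symm)
    (congrFun (h.isDirectOn.eq_of_frequently_isUnsplit hlim hα h'.isDirectOn) 0)

theorem exists_escapesDirectly (hpos : ∀ n, 0 < p n) (hanti : Antitone p) {y : ℕ → ℝ}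
    (hy : IsDirectOn p α univ y) (hlt : ∀ k, |y k| < p k) :
    ∃ s : CrossSection p, EscapesDirectly hpos α s := by
  have hmem : ∀ j, y j ∈ Ico (-p j) (p j) := fun j =>
    ⟨(abs_lt.1 (hlt j)).1.le, (abs_lt.1 (hlt j)).2⟩
  let s : CrossSection p := ⟨(0, y 0), hmem 0⟩
  have hcoe : ∀ j : ℕ, ((returnMap hpos α ^ (j : ℤ)) s).1 = ((j : ℤ), y j) := by
    intro j
    induction j with
    | zero => rfl
    | succ j ih =>
      have hwrap : wrap (hpos j) (y j + α) = y (j + 1) := wrap_eq_iff.2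
        ⟨Ico_subset_Ico (neg_le_neg (hanti j.le_succ)) (hanti j.le_succ) (hmem (j + 1)),
          hy.modEq j trivial trivial⟩
      rw [Nat.cast_succ, returnMap_zpow_add_one, coe_returnMap, ih]
      change (if wrap (hpos j) (y j + α) ∈ Ico (-p (j + 1)) (p (j + 1)) then _ else _,
        wrap (hpos j) (y j + α)) = _
      rw [hwrap, if_pos (hmem (j + 1))]
  exact ⟨s, fun j => by rw [hcoe]⟩

theorem EscapesDirectly.tendsto_fold_flow (hc : 0 < Real.cos θ)
    (h : EscapesDirectly hpos (Real.tan θ) s) :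
    Tendsto (fun t => (fold (flow hpos s θ t)).1) atTop atTop := by
  refine (tendsto_id.atTop_mul_const hc).congr' ?_
  filter_upwards [eventually_ge_atTop 0] with t ht
  have h0 : 0 ≤ t * Real.cos θ := mul_nonneg ht hc.le
  obtain ⟨n, hn⟩ := Int.eq_ofNat_of_zero_le (Int.floor_nonneg.2 h0)
  have hfst : (flow hpos s θ t).1 = t * Real.cos θ := by
    change ((((returnMap hpos _ ^ ⌊t * Real.cos θ⌋) s).1.1 : ℤ) : ℝ) + Int.fract _ = _
    rw [hn, h n, ← hn, Int.floor_add_fract]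
  rw [fold, hfst, abs_of_nonneg h0, id]

theorem isEscapeOrbit_iff (hanti : Antitone p) (hc : 0 < Real.cos θ) (hs : 0 < Real.sin θ)
    {η : Set (ℝ × ℝ)} :
    IsEscapeOrbit p θ η ↔
      ∃ s : CrossSection p, EscapesDirectly hpos (Real.tan θ) s ∧ η = range (flow hpos s θ) := by
  constructor
  · rintro ⟨γ, hγ, rfl, hlim⟩
    obtain ⟨s, c, rfl⟩ := hγ.exists_eq_flow hpos hc hs
    have hlim' : Tendsto (fun t => (fold (flow hpos s θ t)).1) atTop atTop := by
      simpa [Function.comp_def] using hlim.comp (tendsto_atTop_add_const_right _ (-c) tendsto_id)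
    obtain ⟨N, hN⟩ := exists_escapesDirectly_zpow hanti hc hlim'
    refine ⟨_, hN, ?_⟩
    rw [range_flow_zpow hc]
    exact (Equiv.addRight c).surjective.range_comp (flow hpos s θ)
  · rintro ⟨s, hesc, rfl⟩
    exact ⟨_, isTrajectory_flow hpos hc hs, rfl, hesc.tendsto_fold_flow hc⟩

theorem exists_escapesDirectly_and_isEscapeOrbit_iff (hpos : ∀ n, 0 < p n) (hanti : Antitone p)
    (hlim : Tendsto p atTop (𝓝 0)) (hc : 0 < Real.cos θ) (hs : 0 < Real.sin θ)
    (hunsplit : ∃ᶠ m in atTop, ∃ c, IsUnsplit p (Real.tan θ) 0 m c) :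
    ∃ s : CrossSection p, EscapesDirectly hpos (Real.tan θ) s ∧
      ∀ η : Set (ℝ × ℝ), IsEscapeOrbit p θ η ↔ η = range (flow hpos s θ) := by
  obtain ⟨y, hy, hlt⟩ := exists_isDirectOn_univ hpos hlim hunsplit
  obtain ⟨s, hesc⟩ := exists_escapesDirectly hpos hanti hy hlt
  refine ⟨s, hesc, fun η => (isEscapeOrbit_iff hanti hc hs).trans ⟨?_, fun h => ⟨s, hesc, h⟩⟩⟩
  rintro ⟨s', hesc', rfl⟩
  rw [hesc'.eq_of_frequently_isUnsplit hlim hunsplit hesc]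

end Escape

section Vertices

variable {p : ℕ → ℝ} {hpos : ∀ n, 0 < p n} {α θ : ℝ} {s : CrossSection p}

/-- The group generated by the heights of the steps. It is countable, and it contains the heights of
all vertices of the unfolded table, whichever of several identified points represents them. -/
abbrev heightGroup (p : ℕ → ℝ) : Submodule ℤ ℝ := Submodule.span ℤ (range p)

theorem countable_heightGroup (p : ℕ → ℝ) : (heightGroup p : Set ℝ).Countable :=
  countable_coe_iff.1 (inferInstanceAs (Countable (heightGroup p)))

theorem halfHeight_mem_heightGroup (p : ℕ → ℝ) (k : ℤ) : halfHeight p k ∈ heightGroup p := by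
  cases k <;> exact Submodule.subset_span ⟨_, rfl⟩

theorem sub_mem_heightGroup_of_modEq {k : ℤ} {x y : ℝ} (h : x ≡ y [PMOD 2 * halfHeight p k]) :
    x - y ∈ heightGroup p := by
  obtain ⟨z, rfl⟩ := AddCommGroup.modEq_iff_eq_add_zsmul.1 h
  rw [sub_add_cancel_left, two_mul]
  have hk := halfHeight_mem_heightGroup p k
  exact neg_mem (zsmul_mem (add_mem hk hk) z)

theorem returnMap_zpow_snd_sub_mem (hpos : ∀ n, 0 < p n) (α : ℝ) (s : CrossSection p) (i : ℕ) :
    ((returnMap hpos α ^ (i : ℤ)) s).1.2 - s.1.2 - i * α ∈ heightGroup p := by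
  induction i with
  | zero => simp
  | succ i ih =>
    have hstep := sub_mem_heightGroup_of_modEq
      (wrap_modEq (halfHeight_pos hpos ((returnMap hpos α ^ (i : ℤ)) s).1.1)
        (((returnMap hpos α ^ (i : ℤ)) s).1.2 + α))
    rw [Nat.cast_succ, returnMap_zpow_add_one, coe_returnMap]
    convert add_mem hstep ih using 1
    push_cast
    ring

theorem fract_eq_zero_and_snd_mem_heightGroup {z : ℝ × ℝ} (hz : fold z ∈ vertices p) :
    Int.fract z.1 = 0 ∧ z.2 ∈ heightGroup p := by
  have hp : ∀ n, p n ∈ heightGroup p := fun n => Submodule.subset_span ⟨n, rfl⟩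
  obtain ⟨n, hx, hy⟩ : ∃ n : ℤ, |z.1| = n ∧ |z.2| ∈ heightGroup p := by
    simp only [fold, vertices, mem_union, mem_insert_iff, mem_singleton_iff, mem_ofPred_eq,
      Prod.mk.injEq] at hz
    rcases hz with (⟨hx, hy⟩ | ⟨hx, hy⟩) | ⟨n, ⟨hx, hy⟩ | ⟨hx, hy⟩⟩
    · exact ⟨0, by simpa using hx, hy ▸ zero_mem _⟩
    · exact ⟨0, by simpa using hx, hy ▸ hp 0⟩
    · exact ⟨n + 1, by simpa using hx, hy ▸ hp _⟩
    · exact ⟨n + 1, by simpa using hx, hy ▸ hp _⟩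
  refine ⟨Int.fract_eq_zero_iff.2 ?_, abs_mem_iff.1 hy⟩
  rcases abs_eq_abs.1 (hx.trans (abs_of_nonneg (hx ▸ abs_nonneg z.1)).symm) with h | h
  · exact ⟨n, h.symm⟩
  · exact ⟨-n, by rw [h, Int.cast_neg]⟩

theorem exists_snd_mem_heightGroup_of_fold_flow_mem_vertices {t : ℝ}
    (ht : fold (flow hpos s θ t) ∈ vertices p) :
    ∃ N : ℤ, ((returnMap hpos (Real.tan θ) ^ N) s).1.2 ∈ heightGroup p := by
  obtain ⟨hx, hy⟩ := fract_eq_zero_and_snd_mem_heightGroup ht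
  have hfract : Int.fract (t * Real.cos θ) = 0 := by
    simpa [flow, glide] using hx
  rw [flow, hfract, glide_zero] at hy
  exact ⟨_, hy⟩

theorem EscapesDirectly.mem_iInter_corridor (h : EscapesDirectly hpos α s) (n : ℕ) (a : ℝ) :
    α ∈ ⋂ j, corridor p n (n + j) a (((returnMap hpos α ^ (n : ℤ)) s).1.2 - a * α) :=
  mem_iInter.2 fun _ => ⟨_, (add_sub_cancel _ _).symm, h.isDirectOn.mono (subset_univ _)⟩

theorem EscapesDirectly.fold_flow_notMem_vertices (h : EscapesDirectly hpos (Real.tan θ) s)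
    (hθ : ∀ b ∈ heightGroup p, ∀ n i : ℕ, 1 ≤ i →
      Real.tan θ ∉ ⋂ j, corridor p n (n + j) i b) (t : ℝ) :
    fold (flow hpos s θ t) ∉ vertices p := by
  intro ht
  obtain ⟨N, hN⟩ := exists_snd_mem_heightGroup_of_fold_flow_mem_vertices ht
  have habs := abs_nonneg N
  have hneg := neg_abs_le N
  obtain ⟨i, n, hi, hin⟩ : ∃ i n : ℕ, 1 ≤ i ∧ (i : ℤ) + N = n :=
    ⟨(1 + |N|).toNat, (1 + |N| + N).toNat, by omega, by omega⟩
  have hmem := add_mem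
    (returnMap_zpow_snd_sub_mem hpos (Real.tan θ) ((returnMap hpos (Real.tan θ) ^ N) s) i) hN
  rw [← Equiv.Perm.mul_apply, ← zpow_add, hin, sub_right_comm, sub_add_cancel] at hmem
  exact hθ _ hmem n i hi (h.mem_iInter_corridor n i)

theorem ae_forall_notMem_iInter_corridor (hpos : ∀ n, 0 < p n) {r : ℝ} (hr : r < 1 / 2)
    (hp : ∀ n, p (n + 1) ≤ r * p n) :
    ∀ᵐ α : ℝ, ∀ b ∈ heightGroup p, ∀ n i : ℕ, 1 ≤ i →
      α ∉ ⋂ j, corridor p n (n + j) i b := by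
  refine (ae_ball_iff (countable_heightGroup p)).2 fun b _ => ae_all_iff.2 fun n =>
    ae_all_iff.2 fun i => ae_all_iff.2 fun hi => measure_eq_zero_iff_ae_notMem.1 ?_
  exact volume_iInter_corridor_eq_zero hpos (two_mul_lt_of_ratio hpos hr hp)
    (tendsto_two_pow_mul hpos hr hp n) (Nat.one_le_cast.2 hi) b

end Vertices

end StepBilliard

open StepBilliard in
theorem mainTheorem6_general (p : ℕ → ℝ) (r : ℝ) (hpos : ∀ n, 0 < p n) (hr : r < 1 / 3)
    (hp : ∀ n, p (n + 1) ≤ r * p n) :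
    ∀ᵐ θ ∂(volume.restrict (Ioo (0 : ℝ) (Real.pi / 2))),
      ∃ η : Set (ℝ × ℝ), IsEscapeOrbit p θ η ∧
        (∀ η' : Set (ℝ × ℝ), IsEscapeOrbit p θ η' → η' = η) ∧
        ∀ z ∈ η, fold z ∉ vertices p := by
  have hr' : r < 1 / 2 := by linarith
  have hanti : Antitone p := antitone_nat_of_succ_le fun n =>
    (hp n).trans (mul_le_of_le_one_left (hpos n).le (by linarith))
  have hlim : Tendsto p atTop (𝓝 0) := tendsto_zero_of_tendsto_two_pow_mul hpos
    (by simpa using tendsto_two_pow_mul hpos hr' hp 0)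
  filter_upwards [ae_restrict_Ioo_tan (ae_forall_notMem_iInter_corridor hpos hr' hp),
    ae_restrict_Ioo_tan (ae_frequently_forall_notMem_cornerSlopes hpos hr hp),
    ae_restrict_mem measurableSet_Ioo] with θ hθ hcorner hmem
  have hpi := Real.pi_pos
  have hc : 0 < Real.cos θ := Real.cos_pos_of_mem_Ioo ⟨by linarith [hmem.1], hmem.2⟩
  have hs : 0 < Real.sin θ := Real.sin_pos_of_pos_of_lt_pi hmem.1 (by linarith [hmem.2])
  have hunsplit : ∃ᶠ m in atTop, ∃ c, IsUnsplit p (Real.tan θ) 0 m c :=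
    hcorner.mono fun m hm => exists_isUnsplit hpos hm m.zero_le
  obtain ⟨s, hesc, hiff⟩ :=
    exists_escapesDirectly_and_isEscapeOrbit_iff hpos hanti hlim hc hs hunsplit
  refine ⟨range (flow hpos s θ), (hiff _).2 rfl, fun η' => (hiff η').1, ?_⟩
  exact forall_mem_range.2 (hesc.fold_flow_notMem_vertices hθ)

theorem mainTheorem6 (p : ℕ → ℝ) (lam : ℝ)
    (hpos : ∀ n, 0 < p n)
    (hlam : 0 < lam) (hlam' : lam < (Real.sqrt 6 - 1) / 5)
    (hp : ∀ n, p (n + 1) ≤ lam * p n) :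
    ∀ᵐ θ ∂(MeasureTheory.volume.restrict (Set.Ioo (0 : ℝ) (Real.pi / 2))),
      ∃ η : Set (ℝ × ℝ), StepBilliard.IsEscapeOrbit p θ η ∧
        (∀ η' : Set (ℝ × ℝ), StepBilliard.IsEscapeOrbit p θ η' → η' = η) ∧
        ∀ z ∈ η, StepBilliard.fold z ∉ StepBilliard.vertices p := by
  have hsqrt : Real.sqrt 6 < 8 / 3 := (Real.sqrt_lt' (by norm_num)).2 (by norm_num)
  exact mainTheorem6_general p lam hpos (by linarith) hp
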